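/- Let $\mathcal H$ be a real Hilbert space and let $q = \tfrac12\|\cdot\|^2$. For a nonempty subset $C$ of $\mathcal H$ let $d_C$ denote its distance function; if $C$ is moreover closed and convex, let $P_C\colon\mathcal H\to\mathcal H$ denote the projector onto $C$, i.e. $P_Cx$ is the unique point of $C$ nearest to $x$. Let $\mathrm{Proj}(\mathcal H)$ be the set of all operators $P_C$ with $C\subseteq\mathcal H$ nonempty, closed and convex. Sums of sets are Minkowski sums; an empty sum of operators is the zero operator and an empty sum of sets is $\{0\}$. **Theorem (Sum of projectors).** Let $(C_i)_{i\in I}$ be a finite family of nonempty closed convex subsets of $\mathcal H$. Then $\sum_{i\in I}P_{C_i}\in\mathrm{Proj}(\mathcal H)$ if and only if there exists $\gamma\in\mathbb R$ such that $$\sum_{\substack{(i,j)\in I\times I\\ i\neq j}}\langle P_{C_i}x, P_{C_j}x\rangle=\gamma\qquad\text{for all }x\in\mathcal H.$$ In that case, with this $\gamma$, the set $\sum_{i\in I}C_i$ is nonempty, closed and convex, $$\sum_{i\in I}P_{C_i}=P_{\sum_{i\in I}C_i},\qquad d^2_{\sum_{i\in I}C_i}=\sum_{i\in I}d^2_{C_i}-2(\operatorname{card}I-1)\,q+\gamma.$$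 **Corollary (two sets).** Let $C$ and $D$ be nonempty closed convex subsets of $\mathcal H$. Then $P_C+P_D\in\mathrm{Proj}(\mathcal H)$ if and only if there exists $\gamma\in\mathbb R$ such that $\langle P_Cx,P_Dx\rangle=\gamma$ for all $x\in\mathcal H$. In that case, with this $\gamma$, the set $C+D$ is nonempty, closed and convex, $P_C+P_D=P_{C+D}$, and $d^2_{C+D}=d_C^2+d_D^2-2q+2\gamma$. -/

import Mathlib

open scoped Pointwise

/-- `p` is a point of `C` nearest to `x`. -/
def IsNearestPoint {H : Type*} [NormedAddCommGroup H] (C : Set H) (x p : H) : Prop :=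
  p ∈ C ∧ ‖x - p‖ = Metric.infDist x C

/-- In a real Hilbert space, every point has exactly one nearest point in a nonempty closed convex
set, so that the projector below is well defined. -/
theorem existsUnique_isNearestPoint {H : Type*} [NormedAddCommGroup H] [InnerProductSpace ℝ H]
    [CompleteSpace H] {C : Set H} (hne : C.Nonempty) (hcl : IsClosed C) (hcv : Convex ℝ C)
    (x : H) : ∃! p : H, IsNearestPoint C x p := by
  have key : Metric.infDist x C = ⨅ w : C, ‖x - w‖ := by
    rw [Metric.infDist_eq_iInf]
    simp only [dist_eq_norm]
  obtain ⟨p, hp, hpx⟩ := exists_norm_eq_iInf_of_complete_convex hne hcl.isComplete hcv x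
  refine ⟨p, ⟨hp, by rw [key, hpx]⟩, ?_⟩
  rintro y ⟨hy, hyx⟩
  rw [key] at hyx
  have h1 := (norm_eq_iInf_iff_real_inner_le_zero hcv hp).1 hpx y hy
  have h2 := (norm_eq_iInf_iff_real_inner_le_zero hcv hy).1 hyx p hp
  have h3 : inner ℝ (y - p) (y - p) ≤ 0 := by
    have e : inner ℝ (y - p) (y - p) = inner ℝ (x - p) (y - p) + inner ℝ (x - y) (p - y) := by
      have : p - y = -(y - p) := by abel
      rw [this, inner_neg_right, ← sub_eq_add_neg, ← inner_sub_left]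
      congr 1
      abel
    linarith
  exact sub_eq_zero.1 (inner_self_eq_zero.1 (le_antisymm h3 real_inner_self_nonneg))

/-- The projector `P_C`: `projector C x` is the point of `C` nearest to `x`. It is only meaningful
for nonempty closed convex sets `C`. -/
noncomputable def projector {H : Type*} [NormedAddCommGroup H] (C : Set H) : H → H :=
  fun x => Classical.epsilon (IsNearestPoint C x)

theorem projector_spec {H : Type*} [NormedAddCommGroup H] [InnerProductSpace ℝ H]
    [CompleteSpace H] {C : Set H} (hne : C.Nonempty) (hcl : IsClosed C) (hcv : Convex ℝ C)
    (x : H) : IsNearestPoint C x (projector C x) :=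
  Classical.epsilon_spec (existsUnique_isNearestPoint hne hcl hcv x).exists

/-- `Proj(H)`: the set of all projectors `P_C` onto nonempty closed convex subsets `C` of `H`. -/
def Projectors (H : Type*) [NormedAddCommGroup H] [InnerProductSpace ℝ H] : Set (H → H) :=
  {T | ∃ C : Set H, C.Nonempty ∧ IsClosed C ∧ Convex ℝ C ∧ T = projector C}

/-- The function `q = (1/2) ‖·‖²`. -/
noncomputable def halfNormSq {H : Type*} [NormedAddCommGroup H] (x : H) : ℝ :=
  (1 / 2) * ‖x‖ ^ 2

/-! Each `P_C` is the gradient of the convex potential `f_C = (‖·‖² - d_C²)/2`. With `T = ∑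
P_{C_i}`, expanding `‖T x‖²` gives `∑ f_{C_i} x = ⟪x, T x⟫ - ‖T x‖²/2 + (off-diagonal sum)/2`. If `T
= P_D`, then `∑ f_{C_i} - f_D` has zero gradient, hence is constant, and so is the off-diagonal sum.
Conversely, if that sum is constant, the subgradient inequality for `∑ f_{C_i}` says that `T y` is
the point of the range of `T` nearest to `y` (`norm_sub_sum_projector_le`), so the range is closed.
Since `∑ C_i` always lies in the closure of the range (`sum_subset_closure_range_sum_projector`),
the two sets coincide. -/

theorem IsNearestPoint.norm_sub_le {E : Type*} [NormedAddCommGroup E]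
    {C : Set E} {x p c : E} (h : IsNearestPoint C x p)
    (hc : c ∈ C) : ‖x - p‖ ≤ ‖x - c‖ := by
  rw [h.2, ← dist_eq_norm]
  exact Metric.infDist_le_dist_of_mem hc

theorem IsNearestPoint.of_forall_norm_sub_le {E : Type*} [NormedAddCommGroup E]
    {C : Set E} {x p : E} (hp : p ∈ C)
    (h : ∀ c ∈ C, ‖x - p‖ ≤ ‖x - c‖) : IsNearestPoint C x p := by
  refine ⟨hp, le_antisymm ?_ ?_⟩
  · exact (Metric.le_infDist ⟨p, hp⟩).2 fun {c} hc => by rw [dist_eq_norm]; exact h c hc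
  · rw [← dist_eq_norm]
    exact Metric.infDist_le_dist_of_mem hp

/-! ### Projectors as gradients of convex potentials -/

section Projection

variable {H : Type*} [NormedAddCommGroup H] [InnerProductSpace ℝ H]

/-- A Lipschitz continuous, strongly monotone operator on a Hilbert space is surjective. -/
theorem surjective_of_lipschitz_of_stronglyMonotone [CompleteSpace H] {G : H → H} {L ε : ℝ}
    (hε : 0 < ε) (hL : ∀ x y, ‖G x - G y‖ ^ 2 ≤ L ^ 2 * ‖x - y‖ ^ 2)
    (hm : ∀ x y, ε * ‖x - y‖ ^ 2 ≤ inner ℝ (G x - G y) (x - y)) :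
    Function.Surjective G := by
  intro z
  -- With step `t = ε / M`, the squared contraction factor `1 - 2tε + t²L²` is at most `1 - 2tε +
  -- t²M = L²/M < 1`.
  set M : ℝ := L ^ 2 + ε ^ 2 with hM
  have hMpos : 0 < M := by positivity
  set t : ℝ := ε / M with ht
  have htpos : 0 < t := by positivity
  set k : ℝ := Real.sqrt (L ^ 2 / M) with hk
  have hk1 : k < 1 := by
    rw [hk, Real.sqrt_lt' one_pos, one_pow, div_lt_one hMpos]
    nlinarith
  have hk2 : k ^ 2 = L ^ 2 / M := Real.sq_sqrt (by positivity)
  have hk0 : 0 ≤ k := Real.sqrt_nonneg _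
  let Φ : H → H := fun x => x - t • (G x - z)
  have hΦ : ContractingWith k.toNNReal Φ := by
    refine ⟨by rwa [Real.toNNReal_lt_one], LipschitzWith.of_dist_le_mul fun x y => ?_⟩
    rw [dist_eq_norm, dist_eq_norm, Real.coe_toNNReal _ hk0]
    refine abs_le_of_sq_le_sq' ?_ (by positivity) |>.2
    have e : Φ x - Φ y = (x - y) - t • (G x - G y) := by
      simp only [Φ, smul_sub]; abel
    rw [e, @norm_sub_sq_real, inner_smul_right, norm_smul, mul_pow, mul_pow, hk2,
      real_inner_comm, Real.norm_eq_abs, sq_abs]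
    have e2 : L ^ 2 / M = 1 - 2 * (t * ε) + t ^ 2 * M := by
      rw [ht]; field_simp; rw [hM]; ring
    have h1 := mul_le_mul_of_nonneg_left (hm x y) htpos.le
    have h2 := mul_le_mul_of_nonneg_left (hL x y) (sq_nonneg t)
    have h3 : 0 ≤ t ^ 2 * ε ^ 2 * ‖x - y‖ ^ 2 := by positivity
    rw [e2, hM]
    linarith
  obtain ⟨x, hx, -⟩ := hΦ.exists_fixedPoint 0 (edist_ne_top _ _)
  refine ⟨x, ?_⟩
  have hx' : x - t • (G x - z) = x := hx
  have h0 : t • (G x - z) = 0 := by simpa using hx'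
  exact sub_eq_zero.1 ((smul_eq_zero.1 h0).resolve_left htpos.ne')

theorem IsNearestPoint.inner_le_zero {C : Set H} (hcv : Convex ℝ C) {x p c : H}
    (h : IsNearestPoint C x p) (hc : c ∈ C) : inner ℝ (x - p) (c - p) ≤ 0 := by
  refine (norm_eq_iInf_iff_real_inner_le_zero hcv h.1).1 ?_ c hc
  rw [h.2, Metric.infDist_eq_iInf]
  simp only [dist_eq_norm]

variable [CompleteSpace H] {C : Set H}

theorem projector_eq_of_isNearestPoint (hne : C.Nonempty) (hcl : IsClosed C) (hcv : Convex ℝ C)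
    {x p : H} (h : IsNearestPoint C x p) : projector C x = p :=
  (existsUnique_isNearestPoint hne hcl hcv x).unique (projector_spec hne hcl hcv x) h

theorem norm_sq_projector_sub_le (hne : C.Nonempty) (hcl : IsClosed C) (hcv : Convex ℝ C)
    (x y : H) : ‖projector C x - projector C y‖ ^ 2
      ≤ inner ℝ (projector C x - projector C y) (x - y) := by
  have hx := projector_spec hne hcl hcv x
  have hy := projector_spec hne hcl hcv y
  have h1 := hx.inner_le_zero hcv hy.1
  have h2 := hy.inner_le_zero hcv hx.1
  rw [← real_inner_self_eq_norm_sq]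
  simp only [inner_sub_left, inner_sub_right, real_inner_comm] at h1 h2 ⊢
  linarith [real_inner_comm x (projector C x), real_inner_comm x (projector C y),
    real_inner_comm y (projector C x), real_inner_comm y (projector C y),
    real_inner_comm (projector C x) (projector C y)]

theorem norm_projector_sub_le (hne : C.Nonempty) (hcl : IsClosed C) (hcv : Convex ℝ C)
    (x y : H) : ‖projector C x - projector C y‖ ≤ ‖x - y‖ := by
  have h := (norm_sq_projector_sub_le hne hcl hcv x y).trans (real_inner_le_norm _ _)
  by_contra! hlt
  nlinarith [norm_nonneg (x - y)]

/-- The function `x ↦ ⟪x, P_C x⟫ - ‖P_C x‖² / 2`, equal to `(‖x‖² - d_C² x) / 2`. It is a convex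
potential of the projector `P_C`. -/
noncomputable def projectorPotential (C : Set H) (x : H) : ℝ :=
  inner ℝ x (projector C x) - ‖projector C x‖ ^ 2 / 2

/-- Exhibits the potential as a supremum of affine functions of `x`, attained at `c = P_C x`. -/
theorem inner_sub_le_projectorPotential (hne : C.Nonempty) (hcl : IsClosed C) (hcv : Convex ℝ C)
    (x : H) {c : H} (hc : c ∈ C) : inner ℝ x c - ‖c‖ ^ 2 / 2 ≤ projectorPotential C x := by
  have h := (projector_spec hne hcl hcv x).norm_sub_le hc
  have h2 := pow_le_pow_left₀ (norm_nonneg _) h 2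
  rw [@norm_sub_sq_real, @norm_sub_sq_real] at h2
  unfold projectorPotential
  linarith

theorem inner_projector_le_projectorPotential_sub (hne : C.Nonempty) (hcl : IsClosed C)
    (hcv : Convex ℝ C) (x y : H) :
    inner ℝ (projector C x) (y - x) ≤ projectorPotential C y - projectorPotential C x := by
  have h := inner_sub_le_projectorPotential hne hcl hcv y (projector_spec hne hcl hcv x).1
  rw [inner_sub_right, real_inner_comm y, real_inner_comm x]
  unfold projectorPotential at h ⊢
  linarith

/-- Two opposite subgradient inequalities trap the remainder between `0` and `⟪P_C y - P_C x, y -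
x⟫`; nonexpansiveness bounds the latter. -/
theorem abs_projectorPotential_sub_sub_le (hne : C.Nonempty) (hcl : IsClosed C)
    (hcv : Convex ℝ C) (x y : H) :
    |projectorPotential C y - projectorPotential C x - inner ℝ (projector C x) (y - x)|
      ≤ ‖y - x‖ ^ 2 := by
  have h1 := inner_projector_le_projectorPotential_sub hne hcl hcv x y
  have h2 := inner_projector_le_projectorPotential_sub hne hcl hcv y x
  have h3 : inner ℝ (projector C y - projector C x) (y - x) ≤ ‖y - x‖ ^ 2 := by
    rw [sq]
    exact (real_inner_le_norm _ _).trans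
      (mul_le_mul_of_nonneg_right (norm_projector_sub_le hne hcl hcv y x) (norm_nonneg _))
  have h4 : inner ℝ (projector C y) (x - y) = -inner ℝ (projector C y) (y - x) := by
    rw [← inner_neg_right, neg_sub]
  rw [inner_sub_left] at h3
  rw [abs_le]
  constructor <;> nlinarith [sq_nonneg ‖y - x‖]

theorem hasFDerivAt_projectorPotential (hne : C.Nonempty) (hcl : IsClosed C)
    (hcv : Convex ℝ C) (x : H) :
    HasFDerivAt (projectorPotential C) (innerSL ℝ (projector C x)) x := by
  have h : HasFDerivAt (fun y => projectorPotential C y - projectorPotential C x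
      - innerSL ℝ (projector C x) (y - x)) (0 : H →L[ℝ] ℝ) x := by
    refine Asymptotics.IsBigO.hasFDerivAt (n := 2) ?_ one_lt_two
    refine Asymptotics.IsBigO.of_bound 1 (Filter.Eventually.of_forall fun y => ?_)
    rw [Real.norm_eq_abs, one_mul, norm_pow, norm_norm]
    exact abs_projectorPotential_sub_sub_le hne hcl hcv x y
  have h2 : HasFDerivAt (fun y => innerSL ℝ (projector C x) (y - x))
      (innerSL ℝ (projector C x)) x :=
    ((innerSL ℝ (projector C x)).hasFDerivAt).comp x ((hasFDerivAt_id x).sub_const x)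
  have h3 := (h.add h2).add_const (projectorPotential C x)
  rw [zero_add] at h3
  refine h3.congr_of_eventuallyEq (Filter.Eventually.of_forall fun y => ?_)
  simp

/-! ### Density of the range of a sum of projectors in the Minkowski sum -/

theorem exists_sum_projector_add_smul_eq {I : Type*} [Fintype I] {C : I → Set H}
    (hne : ∀ i, (C i).Nonempty)
    (hcl : ∀ i, IsClosed (C i)) (hcv : ∀ i, Convex ℝ (C i)) {ε : ℝ} (hε : 0 < ε) (z : H) :
    ∃ x : H, ∑ i, projector (C i) x + ε • x = z := by
  refine surjective_of_lipschitz_of_stronglyMonotone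
    (G := fun x => ∑ i, projector (C i) x + ε • x) (L := Fintype.card I + ε) hε
    (fun x y => ?_) (fun x y => ?_) z
  · rw [← mul_pow]
    refine pow_le_pow_left₀ (norm_nonneg _) ?_ 2
    rw [add_sub_add_comm, ← Finset.sum_sub_distrib, ← smul_sub, add_mul]
    refine (norm_add_le _ _).trans (add_le_add ?_ ?_)
    · refine (norm_sum_le_of_le _ fun i _ =>
        norm_projector_sub_le (hne i) (hcl i) (hcv i) x y).trans ?_
      simp
    · rw [norm_smul, Real.norm_of_nonneg hε.le]
  · rw [add_sub_add_comm, ← Finset.sum_sub_distrib, ← smul_sub, inner_add_left, sum_inner,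
      real_inner_smul_left, real_inner_self_eq_norm_sq]
    refine le_add_of_nonneg_left (Finset.sum_nonneg fun i _ => ?_)
    exact (sq_nonneg _).trans (norm_sq_projector_sub_le (hne i) (hcl i) (hcv i) x y)

/-- Every point of the Minkowski sum of the sets lies in the closure of the range of the sum of
their projectors. -/
theorem sum_subset_closure_range_sum_projector {I : Type*} [Fintype I]
    {C : I → Set H} (hne : ∀ i, (C i).Nonempty)
    (hcl : ∀ i, IsClosed (C i)) (hcv : ∀ i, Convex ℝ (C i)) :
    ∑ i, C i ⊆ closure (Set.range fun x => ∑ i, projector (C i) x) := by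
  intro z hz
  obtain ⟨c, hc, rfl⟩ := Set.mem_fintype_sum _ _ |>.1 hz
  set F : H → ℝ := fun x => ∑ i, projectorPotential (C i) x with hF
  set K : ℝ := F 0 + ∑ i, ‖c i‖ ^ 2 / 2 with hK
  -- The bound `K` does not depend on `ε`: `F x` is at least `⟪x, ∑ c i⟫ - ∑ ‖c i‖²/2` and at most
  -- `F 0 + ⟪T x, x⟫`, with `T` the sum of the projectors.
  have hbound : ∀ ε : ℝ, 0 < ε → ∀ x : H, ∑ i, projector (C i) x + ε • x = ∑ i, c i →
      ε * ‖x‖ ^ 2 ≤ K := by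
    intro ε _ x hx
    have h1 := Finset.sum_le_sum fun i (_ : i ∈ Finset.univ) =>
      inner_sub_le_projectorPotential (hne i) (hcl i) (hcv i) x (hc i)
    have h2 := Finset.sum_le_sum fun i (_ : i ∈ Finset.univ) =>
      inner_projector_le_projectorPotential_sub (hne i) (hcl i) (hcv i) x 0
    rw [Finset.sum_sub_distrib, ← inner_sum, ← hx, inner_add_right, inner_smul_right,
      real_inner_self_eq_norm_sq] at h1
    rw [Finset.sum_sub_distrib, ← sum_inner, zero_sub, inner_neg_right, real_inner_comm] at h2
    simp only [hK, hF]
    linarith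
  rw [Metric.mem_closure_range_iff]
  intro δ hδ
  -- Chosen so that `‖ε • x‖² ≤ ε * K < δ²`; the `+ 1` makes the inequality strict and the
  -- denominator positive.
  set ε : ℝ := δ ^ 2 / (|K| + 1) with hεd
  have hε : 0 < ε := by positivity
  obtain ⟨x, hx⟩ := exists_sum_projector_add_smul_eq hne hcl hcv hε (∑ i, c i)
  refine ⟨x, ?_⟩
  rw [dist_eq_norm, ← hx, add_sub_cancel_left]
  refine abs_lt_of_sq_lt_sq ?_ hδ.le |> (le_abs_self _).trans_lt
  rw [norm_smul, Real.norm_of_nonneg hε.le]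
  calc (ε * ‖x‖) ^ 2 = ε * (ε * ‖x‖ ^ 2) := by ring
    _ ≤ ε * K := mul_le_mul_of_nonneg_left (hbound ε hε x hx) hε.le
    _ < ε * (|K| + 1) := mul_lt_mul_of_pos_left (by linarith [le_abs_self K]) hε
    _ = δ ^ 2 := by rw [hεd]; field_simp

end Projection

/-! ### The criterion for a finite family -/

section Sum

variable {H : Type*} [NormedAddCommGroup H] [InnerProductSpace ℝ H]
  {I : Type*} [Fintype I] [DecidableEq I]

theorem norm_sum_sq_eq_add_sum_offDiag (v : I → H) :
    ‖∑ i, v i‖ ^ 2 = ∑ i, ‖v i‖ ^ 2 +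
      ∑ p : I × I with p.1 ≠ p.2, inner ℝ (v p.1) (v p.2) := by
  rw [← real_inner_self_eq_norm_sq, sum_inner]
  simp_rw [inner_sum]
  rw [← Fintype.sum_prod_type' (f := fun i j => inner ℝ (v i) (v j)),
    ← Finset.sum_filter_add_sum_filter_not _ (fun p : I × I => p.1 = p.2)]
  congr 1
  rw [Finset.sum_filter, Fintype.sum_prod_type]
  simp

theorem convex_finset_sum {J : Type*} (s : Finset J) {C : J → Set H}
    (hcv : ∀ i, Convex ℝ (C i)) : Convex ℝ (∑ i ∈ s, C i) :=
  Finset.sum_induction C (Convex ℝ) (fun _ _ h1 h2 => h1.add h2) (convex_singleton 0)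
    fun i _ => hcv i

variable {C : I → Set H}

theorem sum_projectorPotential (x : H) :
    ∑ i, projectorPotential (C i) x =
      inner ℝ x (∑ i, projector (C i) x) - ‖∑ i, projector (C i) x‖ ^ 2 / 2 +
        (∑ p : I × I with p.1 ≠ p.2,
          inner ℝ (projector (C p.1) x) (projector (C p.2) x)) / 2 := by
  rw [norm_sum_sq_eq_add_sum_offDiag, inner_sum]
  simp only [projectorPotential, Finset.sum_sub_distrib, Finset.sum_div]
  rw [← Finset.sum_div, ← Finset.sum_div]
  ring

variable [CompleteSpace H]

theorem exists_offDiag_eq_of_sum_projector_mem (hne : ∀ i, (C i).Nonempty)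
    (hcl : ∀ i, IsClosed (C i)) (hcv : ∀ i, Convex ℝ (C i))
    (h : (∑ i, projector (C i)) ∈ Projectors H) :
    ∃ γ : ℝ, ∀ x : H, ∑ p : I × I with p.1 ≠ p.2,
      inner ℝ (projector (C p.1) x) (projector (C p.2) x) = γ := by
  obtain ⟨D, hDne, hDcl, hDcv, hD⟩ := h
  have hT : ∀ x, ∑ i, projector (C i) x = projector D x := fun x => by
    rw [← hD, Finset.sum_apply]
  set G : H → ℝ := fun x => ∑ i, projectorPotential (C i) x - projectorPotential D x with hG
  have hder : ∀ x, HasFDerivAt G 0 x := fun x => by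
    have h1 := (HasFDerivAt.fun_sum (u := Finset.univ) fun i _ =>
      hasFDerivAt_projectorPotential (hne i) (hcl i) (hcv i) x).sub
        (hasFDerivAt_projectorPotential hDne hDcl hDcv x)
    rwa [← map_sum, hT, sub_self] at h1
  have hconst : ∀ x, G x = G 0 := fun x =>
    is_const_of_fderiv_eq_zero (𝕜 := ℝ) (fun y => (hder y).differentiableAt)
      (fun y => (hder y).fderiv) x 0
  refine ⟨2 * G 0, fun x => ?_⟩
  rw [← hconst x]
  simp only [hG]
  rw [sum_projectorPotential, hT, projectorPotential]
  ring

/-- In the summed subgradient inequality from `x` to `y` the two copies of `γ / 2` cancel;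
completing the square leaves a comparison of distances to `y`. -/
theorem norm_sub_sum_projector_le (hne : ∀ i, (C i).Nonempty)
    (hcl : ∀ i, IsClosed (C i)) (hcv : ∀ i, Convex ℝ (C i)) {γ : ℝ}
    (hγ : ∀ x : H, ∑ p : I × I with p.1 ≠ p.2,
      inner ℝ (projector (C p.1) x) (projector (C p.2) x) = γ) (x y : H) :
    ‖y - ∑ i, projector (C i) y‖ ≤ ‖y - ∑ i, projector (C i) x‖ := by
  have h := Finset.sum_le_sum fun i (_ : i ∈ Finset.univ) =>
    inner_projector_le_projectorPotential_sub (hne i) (hcl i) (hcv i) x y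
  rw [← sum_inner, Finset.sum_sub_distrib, sum_projectorPotential, sum_projectorPotential,
    hγ, hγ, inner_sub_right, real_inner_comm y, real_inner_comm x] at h
  refine abs_le_of_sq_le_sq' ?_ (norm_nonneg _) |>.2
  rw [@norm_sub_sq_real, @norm_sub_sq_real]
  linarith

theorem sum_eq_range_sum_projector (hne : ∀ i, (C i).Nonempty)
    (hcl : ∀ i, IsClosed (C i)) (hcv : ∀ i, Convex ℝ (C i)) {γ : ℝ}
    (hγ : ∀ x : H, ∑ p : I × I with p.1 ≠ p.2,
      inner ℝ (projector (C p.1) x) (projector (C p.2) x) = γ) :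
    IsClosed (∑ i, C i) ∧ ∑ i, C i = Set.range fun x => ∑ i, projector (C i) x := by
  have hsub : (Set.range fun x => ∑ i, projector (C i) x) ⊆ ∑ i, C i := by
    rintro _ ⟨x, rfl⟩
    exact Set.mem_fintype_sum _ _ |>.2
      ⟨_, fun i => (projector_spec (hne i) (hcl i) (hcv i) x).1, rfl⟩
  have hclos : closure (Set.range fun x => ∑ i, projector (C i) x) ⊆
      Set.range fun x => ∑ i, projector (C i) x := by
    intro z hz
    -- The image of `z` is at least as close to `z` as any other point of the range, so a limit
    -- point `z` of the range is its own image.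
    have h0 : ‖z - ∑ i, projector (C i) z‖ ≤ 0 := by
      refine le_of_forall_pos_lt_add fun δ hδ => ?_
      obtain ⟨x, hx⟩ := Metric.mem_closure_range_iff.1 hz δ hδ
      rw [dist_eq_norm] at hx
      rw [zero_add]
      exact (norm_sub_sum_projector_le hne hcl hcv hγ x z).trans_lt hx
    exact ⟨z, (sub_eq_zero.1 (norm_le_zero_iff.1 h0)).symm⟩
  have heq := ((sum_subset_closure_range_sum_projector hne hcl hcv).trans hclos).antisymm hsub
  refine ⟨?_, heq⟩
  rw [heq]
  exact isClosed_of_closure_subset hclos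

theorem sum_projector_eq_projector_sum (hne : ∀ i, (C i).Nonempty)
    (hcl : ∀ i, IsClosed (C i)) (hcv : ∀ i, Convex ℝ (C i)) {γ : ℝ}
    (hγ : ∀ x : H, ∑ p : I × I with p.1 ≠ p.2,
      inner ℝ (projector (C p.1) x) (projector (C p.2) x) = γ) :
    (∑ i, C i).Nonempty ∧ IsClosed (∑ i, C i) ∧ Convex ℝ (∑ i, C i) ∧
      ∑ i, projector (C i) = projector (∑ i, C i) ∧
      ∀ x : H, Metric.infDist x (∑ i, C i) ^ 2 =
        (∑ i, Metric.infDist x (C i) ^ 2)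
          - 2 * ((Fintype.card I : ℝ) - 1) * halfNormSq x + γ := by
  obtain ⟨hScl, hS⟩ := sum_eq_range_sum_projector hne hcl hcv hγ
  have hSne : (∑ i, C i).Nonempty := hS ▸ Set.range_nonempty _
  have hScv := convex_finset_sum Finset.univ hcv
  have hnear : ∀ x, IsNearestPoint (∑ i, C i) x (∑ i, projector (C i) x) := fun x => by
    refine IsNearestPoint.of_forall_norm_sub_le (hS ▸ Set.mem_range_self x) ?_
    rw [hS]
    rintro _ ⟨y, rfl⟩
    exact norm_sub_sum_projector_le hne hcl hcv hγ y x
  refine ⟨hSne, hScl, hScv, ?_, fun x => ?_⟩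
  · funext x
    rw [Finset.sum_apply, projector_eq_of_isNearestPoint hSne hScl hScv (hnear x)]
  · have hi : ∀ i, Metric.infDist x (C i) ^ 2 =
        ‖x‖ ^ 2 - 2 * inner ℝ x (projector (C i) x) + ‖projector (C i) x‖ ^ 2 := fun i => by
      rw [← (projector_spec (hne i) (hcl i) (hcv i) x).2, @norm_sub_sq_real]
    simp only [hi]
    rw [← (hnear x).2, @norm_sub_sq_real, norm_sum_sq_eq_add_sum_offDiag, hγ,
      Finset.sum_add_distrib, Finset.sum_sub_distrib, ← Finset.mul_sum, inner_sum]
    simp only [Finset.sum_const, Finset.card_univ, nsmul_eq_mul, halfNormSq]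
    ring

theorem sum_projector_mem_iff (hne : ∀ i, (C i).Nonempty)
    (hcl : ∀ i, IsClosed (C i)) (hcv : ∀ i, Convex ℝ (C i)) :
    (∑ i, projector (C i)) ∈ Projectors H ↔
      ∃ γ : ℝ, ∀ x : H, ∑ p : I × I with p.1 ≠ p.2,
        inner ℝ (projector (C p.1) x) (projector (C p.2) x) = γ := by
  refine ⟨exists_offDiag_eq_of_sum_projector_mem hne hcl hcv, fun ⟨γ, hγ⟩ => ?_⟩
  obtain ⟨h1, h2, h3, h4, -⟩ := sum_projector_eq_projector_sum hne hcl hcv hγ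
  exact ⟨_, h1, h2, h3, h4⟩

end Sum

/-! ### The case of two sets, as a family indexed by `Bool` -/

theorem sum_offDiag_bool {M : Type*} [AddCommMonoid M] (f : Bool → Bool → M) :
    ∑ p : Bool × Bool with p.1 ≠ p.2, f p.1 p.2 = f true false + f false true := by
  rw [Finset.sum_filter, Fintype.sum_prod_type]
  simp

theorem theoremt {H : Type*} [NormedAddCommGroup H] [InnerProductSpace ℝ H] [CompleteSpace H]
    {I : Type*} [Fintype I] [DecidableEq I] :
    (∀ C : I → Set H, (∀ i, (C i).Nonempty) → (∀ i, IsClosed (C i)) → (∀ i, Convex ℝ (C i)) →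
      ((∑ i, projector (C i)) ∈ Projectors H ↔
        ∃ γ : ℝ, ∀ x : H,
          ∑ p : I × I with p.1 ≠ p.2,
            inner ℝ (projector (C p.1) x) (projector (C p.2) x) = γ) ∧
      ∀ γ : ℝ,
        (∀ x : H,
          ∑ p : I × I with p.1 ≠ p.2,
            inner ℝ (projector (C p.1) x) (projector (C p.2) x) = γ) →
        (∑ i, C i).Nonempty ∧ IsClosed (∑ i, C i) ∧ Convex ℝ (∑ i, C i) ∧
        ∑ i, projector (C i) = projector (∑ i, C i) ∧
        ∀ x : H,
          Metric.infDist x (∑ i, C i) ^ 2 =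
            (∑ i, Metric.infDist x (C i) ^ 2)
              - 2 * ((Fintype.card I : ℝ) - 1) * halfNormSq x + γ) ∧
    (∀ C D : Set H, C.Nonempty → IsClosed C → Convex ℝ C → D.Nonempty → IsClosed D → Convex ℝ D →
      (projector C + projector D ∈ Projectors H ↔
        ∃ γ : ℝ, ∀ x : H, inner ℝ (projector C x) (projector D x) = γ) ∧
      ∀ γ : ℝ,
        (∀ x : H, inner ℝ (projector C x) (projector D x) = γ) →
        (C + D).Nonempty ∧ IsClosed (C + D) ∧ Convex ℝ (C + D) ∧
        projector C + projector D = projector (C + D) ∧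
        ∀ x : H,
          Metric.infDist x (C + D) ^ 2 =
            Metric.infDist x C ^ 2 + Metric.infDist x D ^ 2 - 2 * halfNormSq x + 2 * γ) := by
  refine ⟨fun C hne hcl hcv => ⟨sum_projector_mem_iff hne hcl hcv,
    fun γ hγ => sum_projector_eq_projector_sum hne hcl hcv hγ⟩, ?_⟩
  intro C D hC hCcl hCcv hD hDcl hDcv
  let E : Bool → Set H := fun b => if b then C else D
  have hne : ∀ b, (E b).Nonempty := by rintro (_ | _) <;> assumption
  have hcl : ∀ b, IsClosed (E b) := by rintro (_ | _) <;> assumption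
  have hcv : ∀ b, Convex ℝ (E b) := by rintro (_ | _) <;> assumption
  have hP : ∑ b, projector (E b) = projector C + projector D := by simp [E]
  have hE : ∑ b, E b = C + D := by simp [E]
  have hoff : ∀ x : H, ∑ p : Bool × Bool with p.1 ≠ p.2,
      inner ℝ (projector (E p.1) x) (projector (E p.2) x) =
        2 * inner ℝ (projector C x) (projector D x) := fun x => by
    rw [sum_offDiag_bool fun a b => inner ℝ (projector (E a) x) (projector (E b) x)]
    simp only [E, if_true, Bool.false_eq_true, if_false]
    rw [real_inner_comm (projector C x)]
    ring
  have hiff := sum_projector_mem_iff hne hcl hcv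
  simp only [hP, hoff] at hiff
  refine ⟨hiff.trans ⟨fun ⟨γ, h⟩ => ⟨γ / 2, fun x => by linarith [h x]⟩,
    fun ⟨γ, h⟩ => ⟨2 * γ, fun x => by rw [h x]⟩⟩, fun γ hγ => ?_⟩
  -- Both ordered pairs contribute the same inner product, hence the factor `2`.
  obtain ⟨h1, h2, h3, h4, h5⟩ := sum_projector_eq_projector_sum hne hcl hcv (γ := 2 * γ)
    fun x => by rw [hoff, hγ]
  rw [hE] at h1 h2 h3
  rw [hP, hE] at h4
  refine ⟨h1, h2, h3, h4, fun x => ?_⟩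
  have h := h5 x
  rw [hE, Fintype.sum_bool, Fintype.card_bool] at h
  simp only [E, if_true, Bool.false_eq_true, if_false] at h
  rw [h]
  push_cast
  ring
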